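/- Let $m,l_1,k_1,l_2,k_2,d,e\ge 1$ be integers with $l_1\le k_1$ and $l_2\le k_2$, and put $n=l_1l_2d$, $N=k_1k_2e$; assume $N\ge 3m$. For matrices $B_1,\dots,B_k$ of equal size and $l\le k$, let $C_l(B_1,\dots,B_k)$ be the (truncated) circulant block matrix with $l$ block rows and $k$ block columns $$C_l(B_1,\dots,B_k)=\begin{pmatrix}B_k&B_{k-1}&\cdots&B_2&B_1\\ B_1&B_k&\cdots&B_3&B_2\\ \vdots&\vdots&\ddots&\ddots&\vdots\\ B_{l-1}&B_{l-2}&\cdots&\cdots&B_l\end{pmatrix},$$ whose block in position $(a,u)$ is $B_{a-u}$, the index being read modulo $k$. Let $\Upsilon^i_j\in\mathbb{R}^{d\times e}$ ($1\le i\le k_1$, $1\le j\le k_2$) be random matrices such that all entries of all the $\Upsilon^i_j$ are independent and identically distributed, with one of the following three distributions: $N(0,1/n)$; $\pm 1/\sqrt n$ with probability $1/2$ each; or $\pm\sqrt{3/n}$ with probability $1/6$ each and $0$ with probability $2/3$. Put $$\Phi_i=C_{l_2}(\Upsilon^i_1,\dots,\Upsilon^i_{k_2}),\qquad \Phi=C_{l_1}(\Phi_1,\dots,\Phi_{k_1})\in\mathbb{R}^{n\times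 N}.$$ A matrix $A\in\mathbb{R}^{n\times N}$ satisfies RIP of order $s$ and constant $\delta$ if $(1-\delta)\|z\|_2^2\le\|A_Tz\|_2^2\le(1+\delta)\|z\|_2^2$ for all $T\subset\{1,\dots,N\}$ with $|T|\le s$ and all $z\in\mathbb{R}^{|T|}$, where $A_T$ consists of the columns of $A$ indexed by $T$. For every $\delta\in(0,1)$ there are constants $c_1,c_2>0$, depending only on $\delta$, such that for all such $m,l_1,k_1,l_2,k_2,d,e$ and $\Phi$: (i) if $l_1l_2\le 3m(3m-1)$ and $n\ge c_1l_1l_2\,m\ln(N/m)$, then $\Phi$ satisfies RIP of order $3m$ and constant $\delta$ with probability at least $1-e^{-c_2n/(l_1l_2)}$; (ii) if $l_1l_2>3m(3m-1)$ and $n\ge c_1m^3\ln(N/m)$, then $\Phi$ satisfies RIP of order $3m$ and constant $\delta$ with probability at least $1-e^{-c_2n/m^2}$. -/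

import Mathlib

open MeasureTheory ProbabilityTheory
open scoped NNReal ENNReal

/-- The three admissible entry distributions. -/
inductive EntryDist
  | gaussian
  | bernoulli
  | ternary

/-- The law on `ℝ` of a single entry of a random matrix with `n` rows:
`N(0, 1/n)` (mean `0`, variance `1/n`), or `±1/√n` with probability `1/2` each, or
`±√(3/n)` with probability `1/6` each and `0` with probability `2/3`. -/
noncomputable def EntryDist.law (D : EntryDist) (n : ℕ) : Measure ℝ :=
  match D with
  | .gaussian => gaussianReal 0 (1 / (n : ℝ≥0))
  | .bernoulli =>
      (1 / 2 : ℝ≥0∞) • Measure.dirac (1 / √(n : ℝ)) +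
      (1 / 2 : ℝ≥0∞) • Measure.dirac (-(1 / √(n : ℝ)))
  | .ternary =>
      (1 / 6 : ℝ≥0∞) • Measure.dirac √(3 / (n : ℝ)) +
      (2 / 3 : ℝ≥0∞) • Measure.dirac 0 +
      (1 / 6 : ℝ≥0∞) • Measure.dirac (-√(3 / (n : ℝ)))

/-- The (truncated) circulant block matrix with `l` block rows and `k` block columns built from
blocks `B₁, …, B_k`, which are labelled by residues modulo `k` (so that `B_k = B₀`). Its block in
block row `a` and block column `u` (both counted from `0`) is `B_{a - u mod k}`: the first block
row is `B_k, B_{k-1}, …, B_1`, the second one `B_1, B_k, …, B_2`, and the `l`-th one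
`B_{l-1}, B_{l-2}, …, B_l`. -/
def circulantBlock (l k : ℕ) {ι κ : Type*} (B : ZMod k → Matrix ι κ ℝ) :
    Matrix (Fin l × ι) (Fin k × κ) ℝ :=
  Matrix.of fun r c => B (((r.1 : ℕ) : ZMod k) - ((c.1 : ℕ) : ZMod k)) r.2 c.2

/-- The restricted isometry property of order `s` and constant `δ`. Here
`A.submatrix id Subtype.val` is the matrix `A_T` of the columns of `A` indexed by `T`, and the
norms are Euclidean. -/
def SatisfiesRIP {ι κ : Type*} [Fintype ι] (A : Matrix ι κ ℝ) (s : ℕ) (δ : ℝ) : Prop :=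
  ∀ T : Finset κ, T.card ≤ s → ∀ z : EuclideanSpace ℝ T,
    (1 - δ) * ‖z‖ ^ 2 ≤
        ‖WithLp.toLp 2 ((A.submatrix id (Subtype.val : T → κ)).mulVec z.ofLp)‖ ^ 2 ∧
      ‖WithLp.toLp 2 ((A.submatrix id (Subtype.val : T → κ)).mulVec z.ofLp)‖ ^ 2 ≤
        (1 + δ) * ‖z‖ ^ 2

/-!
For a fixed vector `z` supported on at most `s = 3m` columns, `‖Φ z‖² - ‖z‖²` is a sum over the rows
of centred squares of sub-Gaussian variables, hence of sub-exponential variables. Rows that share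
entries of `Υ` are dependent. Join two rows by an edge when they share an entry within the support
of `z`, and colour this overlap graph: rows of equal colour are independent, and Hölder's inequality
across `q` colours gives the usual Bernstein bound with `n / q` in place of `n`. The position of a
row within the circulant structure is a colouring with `l₁ l₂` colours, which gives (i). Each row
also meets at most `s (s - 1)` other rows, so that greedy colouring needs only `s (s - 1) + 1 ≤ 9m²`
colours, which gives (ii). A union bound over supports and over a net of the sphere costs a factor
`(e N / s) ^ s * 25 ^ s`, which is absorbed by the lower bound on `n`.
-/

section ExponentialSquare

lemma lintegral_exp_sq_div_four_gaussianReal_le :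
    ∫⁻ g, ENNReal.ofReal (Real.exp (g ^ 2 / 4)) ∂(gaussianReal 0 1) ≤ ENNReal.ofReal √2 := by
  rw [gaussianReal_of_var_ne_zero 0 one_ne_zero,
    lintegral_withDensity_eq_lintegral_mul _ (measurable_gaussianPDF 0 1) (by fun_prop)]
  have density_mul : ∀ x : ℝ,
      (gaussianPDF 0 1 * fun g : ℝ => ENNReal.ofReal (Real.exp (g ^ 2 / 4))) x =
        ENNReal.ofReal ((√(2 * Real.pi))⁻¹ * Real.exp (-(1 / 4) * x ^ 2)) := by
    intro x
    rw [Pi.mul_apply, gaussianPDF, ← ENNReal.ofReal_mul (gaussianPDFReal_nonneg _ _ _),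
      gaussianPDFReal, mul_assoc, ← Real.exp_add]
    norm_num
    ring_nf
  rw [lintegral_congr density_mul, ← ofReal_integral_eq_lintegral_ofReal
    ((integrable_exp_neg_mul_sq (by norm_num)).const_mul _) (.of_forall fun x => by positivity),
    integral_const_mul, integral_gaussian, ← Real.sqrt_inv, ← Real.sqrt_mul (by positivity)]
  gcongr
  exact le_of_eq (by field_simp; norm_num)

lemma ofReal_exp_sq_div_eq_lintegral_gaussianReal {c : ℝ} (hc : 0 < c) (w : ℝ) :
    ENNReal.ofReal (Real.exp (w ^ 2 / (4 * c))) =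
      ∫⁻ g, ENNReal.ofReal (Real.exp (g / √(2 * c) * w)) ∂(gaussianReal 0 1) := by
  simp_rw [div_mul_comm _ _ w]
  rw [← ofReal_integral_eq_lintegral_ofReal (by simpa using integrable_exp_mul_gaussianReal _)
    (.of_forall fun x => by positivity)]
  have mgf_eq := congrFun (mgf_id_gaussianReal (μ := 0) (v := 1)) (w / √(2 * c))
  simp only [mgf, id] at mgf_eq
  rw [mgf_eq, div_pow, Real.sq_sqrt (by positivity)]
  congr 2
  simp only [NNReal.coe_one]
  field_simp
  ring

variable {Ω : Type*} [MeasurableSpace Ω] {P : Measure Ω} {W : Ω → ℝ} {c : ℝ≥0}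

-- Writing `exp (W² / 4c)` as a Gaussian average of `exp (s W)` and exchanging the integrals reduces
-- the claim to the Gaussian case.
lemma lintegral_exp_sq_le_of_hasSubgaussianMGF [SFinite P] (hc : c ≠ 0)
    (hW : HasSubgaussianMGF W c P) :
    ∫⁻ ω, ENNReal.ofReal (Real.exp (W ω ^ 2 / (4 * c))) ∂P ≤ ENNReal.ofReal √2 := by
  have hc₀ : (0 : ℝ) < c := by positivity
  have mgf_le : ∀ g : ℝ, ∫⁻ ω, ENNReal.ofReal (Real.exp (g / √(2 * c) * W ω)) ∂P ≤
      ENNReal.ofReal (Real.exp (g ^ 2 / 4)) := by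
    intro g
    rw [← ofReal_integral_eq_lintegral_ofReal (hW.integrable_exp_mul _)
      (.of_forall fun x => by positivity)]
    gcongr
    refine (hW.mgf_le _).trans (Real.exp_le_exp.2 (le_of_eq ?_))
    rw [div_pow, Real.sq_sqrt (by positivity)]
    field_simp
    norm_num
  have hWm := hW.aemeasurable
  calc ∫⁻ ω, ENNReal.ofReal (Real.exp (W ω ^ 2 / (4 * c))) ∂P
      = ∫⁻ ω, ∫⁻ g, ENNReal.ofReal (Real.exp (g / √(2 * c) * W ω)) ∂(gaussianReal 0 1) ∂P :=
        lintegral_congr fun ω => ofReal_exp_sq_div_eq_lintegral_gaussianReal hc₀ _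
    _ = ∫⁻ g, ∫⁻ ω, ENNReal.ofReal (Real.exp (g / √(2 * c) * W ω)) ∂P ∂(gaussianReal 0 1) := by
        refine lintegral_lintegral_swap (AEMeasurable.ennreal_ofReal (AEMeasurable.exp ?_))
        exact (measurable_snd.aemeasurable.div_const _).mul hWm.comp_fst
    _ ≤ ∫⁻ g, ENNReal.ofReal (Real.exp (g ^ 2 / 4)) ∂(gaussianReal 0 1) := lintegral_mono mgf_le
    _ ≤ ENNReal.ofReal √2 := lintegral_exp_sq_div_four_gaussianReal_le

lemma exp_le_one_add_add_sq_mul_exp_abs (x : ℝ) :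
    Real.exp x ≤ 1 + x + x ^ 2 * Real.exp |x| := by
  have h := Complex.norm_exp_sub_sum_le_norm_mul_exp (x : ℂ) 2
  have norm_eq : ‖Complex.exp x - ∑ m ∈ Finset.range 2, (x : ℂ) ^ m / m.factorial‖ =
      |Real.exp x - (1 + x)| := by
    rw [← Real.norm_eq_abs, ← Complex.norm_real]
    simp [Finset.sum_range_succ]
  rw [norm_eq, Complex.norm_real, Real.norm_eq_abs, sq_abs] at h
  linarith [le_abs_self (Real.exp x - (1 + x))]

end ExponentialSquare

/-- Sub-exponential random variables: the moment generating function of `X` is at most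
`exp (a² θ²)` for `|θ| ≤ 1 / a`. A single parameter `a` serves both as the scale of the bound and as
the inverse of its range, and the lower integral makes integrability part of the condition. -/
structure HasSubexponentialMGF {Ω : Type*} [MeasurableSpace Ω] (X : Ω → ℝ) (a : ℝ)
    (P : Measure Ω) : Prop where
  aemeasurable : AEMeasurable X P
  lintegral_exp_le : ∀ θ : ℝ, |θ| * a ≤ 1 →
    ∫⁻ ω, ENNReal.ofReal (Real.exp (θ * X ω)) ∂P ≤ ENNReal.ofReal (Real.exp (a ^ 2 * θ ^ 2))

section Centring

lemma exp_mul_sub_le {b θ s x : ℝ} (hb : 0 < b) (hθ : |θ| * (4 * b) ≤ 1) (hs : 0 ≤ s)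
    (hx : 0 ≤ x) :
    Real.exp (θ * (x - s)) ≤
      1 + θ * (x - s) + 8 * b ^ 2 * θ ^ 2 * Real.exp (s / b) * Real.exp (x / b) := by
  set V := x - s
  have sq_le : V ^ 2 ≤ 8 * b ^ 2 * Real.exp (|V| / (2 * b)) := by
    have h := Real.pow_div_factorial_le_exp (|V| / (2 * b)) (by positivity) 2
    rw [div_pow, sq_abs, Nat.factorial_two, div_div, div_le_iff₀ (by positivity)] at h
    push_cast at h
    linarith
  have abs_mul_le : |θ * V| ≤ |V| / (2 * b) := by
    rw [abs_mul, le_div_iff₀ (by positivity)]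
    nlinarith [mul_le_mul_of_nonneg_right hθ (abs_nonneg V), abs_nonneg V]
  have abs_div_le : |V| / b ≤ s / b + x / b := by
    rw [← add_div]
    gcongr
    exact abs_le.2 ⟨by linarith, by linarith⟩
  calc Real.exp (θ * V) ≤ 1 + θ * V + (θ * V) ^ 2 * Real.exp |θ * V| :=
        exp_le_one_add_add_sq_mul_exp_abs _
    _ ≤ 1 + θ * V + θ ^ 2 * (8 * b ^ 2 * Real.exp (|V| / (2 * b))) *
          Real.exp (|V| / (2 * b)) := by
        rw [mul_pow]
        gcongr
    _ = 1 + θ * V + 8 * b ^ 2 * θ ^ 2 * Real.exp (|V| / b) := by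
        have : |V| / b = |V| / (2 * b) + |V| / (2 * b) := by field_simp; norm_num
        rw [this, Real.exp_add]
        ring
    _ ≤ 1 + θ * V + 8 * b ^ 2 * θ ^ 2 * Real.exp (s / b) * Real.exp (x / b) := by
        rw [mul_assoc _ (Real.exp _), ← Real.exp_add]
        gcongr

variable {Ω : Type*} [MeasurableSpace Ω] {P : Measure Ω} [IsProbabilityMeasure P]

lemma exp_integral_div_le {X : Ω → ℝ} {b : ℝ} (hX : Integrable X P)
    (hexp : Integrable (fun ω => Real.exp (X ω / b)) P) :
    Real.exp ((∫ ω, X ω ∂P) / b) ≤ ∫ ω, Real.exp (X ω / b) ∂P := by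
  rw [← integral_div]
  exact convexOn_exp.map_integral_le Real.continuous_exp.continuousOn isClosed_univ (by simp)
    (hX.div_const b) hexp

lemma hasSubexponentialMGF_sub_integral {X : Ω → ℝ} {b : ℝ} (hb : 0 < b) (hX : Integrable X P)
    (hpos : 0 ≤ X) (hexp : Integrable (fun ω => Real.exp (X ω / b)) P)
    (hle : ∫ ω, Real.exp (X ω / b) ∂P ≤ √2) :
    HasSubexponentialMGF (fun ω => X ω - ∫ ω', X ω' ∂P) (4 * b) P := by
  refine ⟨by fun_prop, fun θ hθ => ?_⟩
  set s := ∫ ω, X ω ∂P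
  have hs : Real.exp (s / b) ≤ √2 := (exp_integral_div_le hX hexp).trans hle
  have hlin : Integrable (fun ω => 1 + θ * (X ω - s)) P := by fun_prop
  have hquad : Integrable
      (fun ω => 8 * b ^ 2 * θ ^ 2 * Real.exp (s / b) * Real.exp (X ω / b)) P := hexp.const_mul _
  have pointwise ω := exp_mul_sub_le hb hθ (s := s) (integral_nonneg hpos) (hpos ω)
  calc ∫⁻ ω, ENNReal.ofReal (Real.exp (θ * (X ω - s))) ∂P
      ≤ ∫⁻ ω, ENNReal.ofReal (1 + θ * (X ω - s) +
          8 * b ^ 2 * θ ^ 2 * Real.exp (s / b) * Real.exp (X ω / b)) ∂P :=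
        lintegral_mono fun ω => ENNReal.ofReal_le_ofReal (pointwise ω)
    _ = ENNReal.ofReal (∫ ω, (1 + θ * (X ω - s) +
          8 * b ^ 2 * θ ^ 2 * Real.exp (s / b) * Real.exp (X ω / b)) ∂P) :=
        (ofReal_integral_eq_lintegral_ofReal (hlin.add hquad)
          (.of_forall fun ω => (Real.exp_pos _).le.trans (pointwise ω))).symm
    _ = ENNReal.ofReal (1 +
          8 * b ^ 2 * θ ^ 2 * Real.exp (s / b) * ∫ ω, Real.exp (X ω / b) ∂P) := by
        rw [integral_add hlin hquad, integral_add (by fun_prop) (by fun_prop), integral_const_mul,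
          integral_const_mul, integral_sub hX (integrable_const _)]
        simp [s]
    _ ≤ ENNReal.ofReal (1 + 8 * b ^ 2 * θ ^ 2 * √2 * √2) := by gcongr
    _ ≤ ENNReal.ofReal (Real.exp ((4 * b) ^ 2 * θ ^ 2)) := by
        gcongr
        refine le_trans (le_of_eq ?_) (Real.add_one_le_exp _)
        rw [mul_assoc _ √2, Real.mul_self_sqrt zero_le_two]
        ring

variable {W : Ω → ℝ} {c : ℝ≥0}

lemma integrable_exp_sq_of_hasSubgaussianMGF (hc : c ≠ 0) (hW : HasSubgaussianMGF W c P) :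
    Integrable (fun ω => Real.exp (W ω ^ 2 / (4 * c))) P := by
  have := hW.aemeasurable
  refine ⟨by fun_prop, ?_⟩
  rw [hasFiniteIntegral_iff_ofReal (.of_forall fun _ => by positivity)]
  exact (lintegral_exp_sq_le_of_hasSubgaussianMGF hc hW).trans_lt ENNReal.ofReal_lt_top

lemma integral_exp_sq_le_of_hasSubgaussianMGF (hc : c ≠ 0) (hW : HasSubgaussianMGF W c P) :
    ∫ ω, Real.exp (W ω ^ 2 / (4 * c)) ∂P ≤ √2 := by
  rw [integral_eq_lintegral_of_nonneg_ae (.of_forall fun _ => by positivity)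
    (integrable_exp_sq_of_hasSubgaussianMGF hc hW).aestronglyMeasurable]
  exact ENNReal.toReal_le_of_le_ofReal (by positivity)
    (lintegral_exp_sq_le_of_hasSubgaussianMGF hc hW)

lemma integral_sq_le_of_hasSubgaussianMGF (hc : c ≠ 0) (hW : HasSubgaussianMGF W c P) :
    ∫ ω, W ω ^ 2 ∂P ≤ 4 * c := by
  have exp_le := (exp_integral_div_le (hW.memLp 2).integrable_sq
    (integrable_exp_sq_of_hasSubgaussianMGF hc hW)).trans
    (integral_exp_sq_le_of_hasSubgaussianMGF hc hW)
  have sqrt_two_le : √2 ≤ 2 := Real.sqrt_le_iff.2 ⟨by norm_num, by norm_num⟩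
  have div_le : (∫ ω, W ω ^ 2 ∂P) / (4 * c) ≤ 1 := by
    linarith [Real.add_one_le_exp ((∫ ω, W ω ^ 2 ∂P) / (4 * c))]
  have hc₀ : (0 : ℝ) < c := by positivity
  rwa [div_le_one (by positivity)] at div_le

lemma hasSubexponentialMGF_sq_sub_integral_sq (hc : c ≠ 0) (hW : HasSubgaussianMGF W c P) :
    HasSubexponentialMGF (fun ω => W ω ^ 2 - ∫ ω', W ω' ^ 2 ∂P) (16 * c) P := by
  have h := hasSubexponentialMGF_sub_integral (P := P) (b := 4 * c) (by positivity)
    (hW.memLp 2).integrable_sq (fun ω => sq_nonneg (W ω))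
    (integrable_exp_sq_of_hasSubgaussianMGF hc hW) (integral_exp_sq_le_of_hasSubgaussianMGF hc hW)
  convert h using 1
  ring

end Centring

section Independence

variable {Ω ι κ : Type*} [MeasurableSpace Ω] {P : Measure Ω}

lemma iIndepFun_curry {E : Type*} [MeasurableSpace E] [Countable ι] [Countable κ]
    {X : ι × κ → Ω → E} (hX : ∀ p, AEMeasurable (X p) P) (hind : iIndepFun X P) :
    iIndepFun (fun i ω k => X (i, k) ω) P := by
  have := hind.isProbabilityMeasure
  have (p : ι × κ) : IsProbabilityMeasure (P.map (X p)) := Measure.isProbabilityMeasure_map (hX p)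
  have map_row (i : ι) : P.map (fun ω k => X (i, k) ω) =
      Measure.infinitePi fun k => P.map (X (i, k)) :=
    (hind.precomp (Prod.mk_right_injective i)).map_fun_eq_infinitePi_map₀' fun k => hX (i, k)
  rw [iIndepFun_iff_map_fun_eq_infinitePi_map₀' fun i => aemeasurable_pi_iff.2 fun k => hX (i, k)]
  simp_rw [map_row]
  rw [← Measure.infinitePi_map_curry fun i k => P.map (X (i, k)),
    ← hind.map_fun_eq_infinitePi_map₀' hX, AEMeasurable.map_map_of_aemeasurable (by fun_prop)
      (aemeasurable_pi_iff.2 hX)]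
  rfl

lemma lintegral_prod_eq_prod_lintegral_of_iIndepFun [Fintype ι] {f : ι → Ω → ℝ≥0∞}
    (hf : ∀ i, AEMeasurable (f i) P) (hind : iIndepFun f P) :
    ∫⁻ ω, ∏ i, f i ω ∂P = ∏ i, ∫⁻ ω, f i ω ∂P := by
  have h := lintegral_prod_eq_prod_lintegral_of_indepFun Finset.univ (fun i => (hf i).mk (f i))
    (hind.congr fun i => (hf i).ae_eq_mk) fun i => (hf i).measurable_mk
  simp_rw [fun i => lintegral_congr_ae (hf i).ae_eq_mk]
  rw [← h]
  refine lintegral_congr_ae ?_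
  filter_upwards [ae_all_iff.2 fun i => (hf i).ae_eq_mk] with ω hω
  exact Finset.prod_congr rfl fun i _ => hω i

lemma lintegral_exp_sum_le_prod_rpow [Fintype ι] [Nonempty ι] {f : ι → Ω → ℝ}
    (hf : ∀ i, AEMeasurable (f i) P) :
    ∫⁻ ω, ENNReal.ofReal (Real.exp (∑ i, f i ω)) ∂P ≤
      ∏ i, (∫⁻ ω, ENNReal.ofReal (Real.exp (Fintype.card ι * f i ω)) ∂P) ^
        (1 / Fintype.card ι : ℝ) := by
  have exp_sum_eq (ω : Ω) : ENNReal.ofReal (Real.exp (∑ i, f i ω)) =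
      ∏ i, ENNReal.ofReal (Real.exp (Fintype.card ι * f i ω)) ^ (1 / Fintype.card ι : ℝ) := by
    rw [Real.exp_sum, ENNReal.ofReal_prod_of_nonneg fun _ _ => by positivity]
    refine Finset.prod_congr rfl fun i _ => ?_
    rw [ENNReal.ofReal_rpow_of_pos (Real.exp_pos _), ← Real.exp_mul]
    field_simp
  simp_rw [exp_sum_eq]
  refine ENNReal.lintegral_prod_norm_pow_le _ (fun i _ => ?_) ?_ fun _ _ => by positivity
  · exact (((hf i).const_mul _).exp).ennreal_ofReal
  · simp

end Independence

namespace HasSubexponentialMGF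

variable {Ω R ι : Type*} [MeasurableSpace Ω] {P : Measure Ω} {V : R → Ω → ℝ} {a : ℝ}

lemma neg {X : Ω → ℝ} (hX : HasSubexponentialMGF X a P) :
    HasSubexponentialMGF (fun ω => -X ω) a P where
  aemeasurable := hX.aemeasurable.neg
  lintegral_exp_le θ hθ := by
    simpa using hX.lintegral_exp_le (-θ) (by rwa [abs_neg])

lemma lintegral_exp_sum_le_of_iIndepFun [Fintype R] (hV : ∀ r, HasSubexponentialMGF (V r) a P)
    (hind : iIndepFun V P) {θ : ℝ} (hθ : |θ| * a ≤ 1) :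
    ∫⁻ ω, ENNReal.ofReal (Real.exp (θ * ∑ r, V r ω)) ∂P ≤
      ENNReal.ofReal (Real.exp (a ^ 2 * θ ^ 2 * Fintype.card R)) := by
  have hmeas (r : R) : AEMeasurable (fun ω => ENNReal.ofReal (Real.exp (θ * V r ω))) P :=
    (((hV r).aemeasurable.const_mul θ).exp).ennreal_ofReal
  have hind_exp : iIndepFun (fun r ω => ENNReal.ofReal (Real.exp (θ * V r ω))) P :=
    hind.comp (fun _ x => ENNReal.ofReal (Real.exp (θ * x))) fun _ => by fun_prop
  calc ∫⁻ ω, ENNReal.ofReal (Real.exp (θ * ∑ r, V r ω)) ∂P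
      = ∫⁻ ω, ∏ r, ENNReal.ofReal (Real.exp (θ * V r ω)) ∂P := by
        simp_rw [Finset.mul_sum, Real.exp_sum]
        simp_rw [ENNReal.ofReal_prod_of_nonneg fun _ _ => (Real.exp_pos _).le]
    _ = ∏ r, ∫⁻ ω, ENNReal.ofReal (Real.exp (θ * V r ω)) ∂P :=
        lintegral_prod_eq_prod_lintegral_of_iIndepFun hmeas hind_exp
    _ ≤ ∏ _r : R, ENNReal.ofReal (Real.exp (a ^ 2 * θ ^ 2)) :=
        Finset.prod_le_prod' fun r _ => (hV r).lintegral_exp_le θ hθ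
    _ = ENNReal.ofReal (Real.exp (a ^ 2 * θ ^ 2 * Fintype.card R)) := by
        rw [Finset.prod_const, Finset.card_univ, ← ENNReal.ofReal_pow (Real.exp_pos _).le,
          ← Real.exp_nat_mul, mul_comm]

variable [Fintype R] [Fintype ι] [Nonempty ι] {C : R → ι}

-- Hölder's inequality with one factor per colour separates the colours.
lemma lintegral_exp_sum_le_of_coloring (hV : ∀ r, HasSubexponentialMGF (V r) a P)
    (hind : ∀ g, iIndepFun (fun r : {r // C r = g} => V r) P) {θ : ℝ}
    (hθ : |θ| * Fintype.card ι * a ≤ 1) :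
    ∫⁻ ω, ENNReal.ofReal (Real.exp (θ * ∑ r, V r ω)) ∂P ≤
      ENNReal.ofReal (Real.exp (a ^ 2 * θ ^ 2 * Fintype.card ι * Fintype.card R)) := by
  classical
  set q := Fintype.card ι with hq
  have hq₀ : (q : ℝ) ≠ 0 := by simp [hq]
  have hmeas (g : ι) : AEMeasurable (fun ω => θ * ∑ r : {r // C r = g}, V r ω) P :=
    (Finset.aemeasurable_fun_sum _ fun (r : {r // C r = g}) _ =>
      (hV r).aemeasurable).const_mul θ
  calc ∫⁻ ω, ENNReal.ofReal (Real.exp (θ * ∑ r, V r ω)) ∂P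
      = ∫⁻ ω, ENNReal.ofReal (Real.exp (∑ g, θ * ∑ r : {r // C r = g}, V r ω)) ∂P := by
        simp_rw [← Finset.mul_sum, fun ω => Fintype.sum_fiberwise C fun r => V r ω]
    _ ≤ ∏ g, (∫⁻ ω, ENNReal.ofReal (Real.exp (q * (θ * ∑ r : {r // C r = g}, V r ω))) ∂P) ^
          (1 / q : ℝ) :=
        lintegral_exp_sum_le_prod_rpow hmeas
    _ ≤ ∏ g, ENNReal.ofReal
          (Real.exp (a ^ 2 * (q * θ) ^ 2 * Fintype.card {r // C r = g})) ^ (1 / q : ℝ) := by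
        gcongr with g
        simp_rw [← mul_assoc (q : ℝ)]
        refine lintegral_exp_sum_le_of_iIndepFun (fun r : {r // C r = g} => hV r) (hind g) ?_
        rwa [abs_mul, Nat.abs_cast, mul_comm (q : ℝ)]
    _ = ∏ g, ENNReal.ofReal (Real.exp (a ^ 2 * θ ^ 2 * q * Fintype.card {r // C r = g})) := by
        refine Finset.prod_congr rfl fun g _ => ?_
        rw [ENNReal.ofReal_rpow_of_pos (Real.exp_pos _), ← Real.exp_mul, mul_pow]
        congr 2
        field_simp
    _ = ENNReal.ofReal (Real.exp (a ^ 2 * θ ^ 2 * q * Fintype.card R)) := by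
        rw [← ENNReal.ofReal_prod_of_nonneg fun _ _ => (Real.exp_pos _).le, ← Real.exp_sum,
          ← Finset.mul_sum, ← Nat.cast_sum, ← Fintype.card_sigma,
          Fintype.card_congr (Equiv.sigmaFiberEquiv C)]

lemma measure_ge_le_of_coloring [Nonempty R] (ha : 0 < a)
    (hV : ∀ r, HasSubexponentialMGF (V r) a P)
    (hind : ∀ g, iIndepFun (fun r : {r // C r = g} => V r) P) {t : ℝ} (ht₀ : 0 ≤ t)
    (ht : t ≤ 2 * a * Fintype.card R) :
    P {ω | t ≤ ∑ r, V r ω} ≤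
      ENNReal.ofReal (Real.exp (-(t ^ 2 / (4 * a ^ 2 * Fintype.card ι * Fintype.card R)))) := by
  set q := Fintype.card ι with hq
  have hq₀ : (0 : ℝ) < q := by simp [hq, Fintype.card_pos]
  have : (0 : ℝ) < Fintype.card R := by simp [Fintype.card_pos]
  -- `θ` minimises `a² θ² q |R| - θ t`.
  set θ := t / (2 * a ^ 2 * q * Fintype.card R) with hθ
  have θ_nonneg : 0 ≤ θ := by positivity
  have hθ_le : |θ| * q * a ≤ 1 := by
    rw [abs_of_nonneg θ_nonneg, hθ, div_mul_eq_mul_div, div_mul_eq_mul_div,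
      div_le_one (by positivity)]
    nlinarith [mul_le_mul_of_nonneg_right ht (mul_pos hq₀ ha).le]
  have hmeas : AEMeasurable (fun ω => ENNReal.ofReal (Real.exp (θ * ∑ r, V r ω))) P :=
    (((Finset.aemeasurable_fun_sum _ fun r _ =>
      (hV r).aemeasurable).const_mul θ).exp).ennreal_ofReal
  have markov := mul_meas_ge_le_lintegral₀ hmeas (ENNReal.ofReal (Real.exp (θ * t)))
  calc P {ω | t ≤ ∑ r, V r ω}
      ≤ P {ω | ENNReal.ofReal (Real.exp (θ * t)) ≤
          ENNReal.ofReal (Real.exp (θ * ∑ r, V r ω))} :=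
        measure_mono fun ω (hω : t ≤ ∑ r, V r ω) => ENNReal.ofReal_le_ofReal
          (Real.exp_le_exp.2 (mul_le_mul_of_nonneg_left hω θ_nonneg))
    _ ≤ ENNReal.ofReal (Real.exp (a ^ 2 * θ ^ 2 * q * Fintype.card R)) /
          ENNReal.ofReal (Real.exp (θ * t)) := by
        rw [ENNReal.le_div_iff_mul_le (by simp [Real.exp_pos]) (by simp), mul_comm]
        exact markov.trans (lintegral_exp_sum_le_of_coloring hV hind hθ_le)
    _ = ENNReal.ofReal (Real.exp (-(t ^ 2 / (4 * a ^ 2 * q * Fintype.card R)))) := by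
        rw [← ENNReal.ofReal_div_of_pos (Real.exp_pos _), ← Real.exp_sub, hθ]
        congr 2
        field_simp
        ring

lemma measure_abs_ge_le_of_coloring [Nonempty R] (ha : 0 < a)
    (hV : ∀ r, HasSubexponentialMGF (V r) a P)
    (hind : ∀ g, iIndepFun (fun r : {r // C r = g} => V r) P) {t : ℝ} (ht₀ : 0 ≤ t)
    (ht : t ≤ 2 * a * Fintype.card R) :
    P {ω | t ≤ |∑ r, V r ω|} ≤
      2 * ENNReal.ofReal
        (Real.exp (-(t ^ 2 / (4 * a ^ 2 * Fintype.card ι * Fintype.card R)))) := by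
  have upper := measure_ge_le_of_coloring ha hV hind ht₀ ht
  have lower := measure_ge_le_of_coloring ha (fun r => (hV r).neg)
    (fun g => (hind g).comp (fun _ x => -x) fun _ => measurable_neg) ht₀ ht
  calc P {ω | t ≤ |∑ r, V r ω|}
      ≤ P ({ω | t ≤ ∑ r, V r ω} ∪ {ω | t ≤ ∑ r, -V r ω}) := by
        refine measure_mono fun ω (hω : t ≤ |∑ r, V r ω|) => (le_abs.1 hω).imp id fun h => ?_
        rwa [Set.mem_ofPred_eq, Finset.sum_neg_distrib]
    _ ≤ _ := (measure_union_le _ _).trans (add_le_add upper lower)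
    _ = _ := (two_mul _).symm

end HasSubexponentialMGF

section LinearCombination

variable {Ω κ : Type*} [MeasurableSpace Ω] {P : Measure Ω} {c : ℝ≥0}

lemma hasSubgaussianMGF_of_le {W : Ω → ℝ} {c' : ℝ≥0} (hW : HasSubgaussianMGF W c P) (hc : c ≤ c') :
    HasSubgaussianMGF W c' P where
  integrable_exp_mul := hW.integrable_exp_mul
  mgf_le t := (hW.mgf_le t).trans <| Real.exp_le_exp.2 <| by gcongr

-- `mgf W t ≤ exp (c t² / 2)` with equality at `t = 0`, where the derivatives must thus agree.
lemma integral_eq_zero_of_hasSubgaussianMGF [IsProbabilityMeasure P] {W : Ω → ℝ}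
    (hW : HasSubgaussianMGF W c P) : ∫ ω, W ω ∂P = 0 := by
  have hasDerivAt_mgf_zero : HasDerivAt (mgf W P) (∫ ω, W ω ∂P) 0 := by
    simpa using hasDerivAt_mgf (X := W) (μ := P) (t := 0) (by simp [hW.integrableExpSet_eq_univ])
  have hasDerivAt_exp_zero : HasDerivAt (fun t : ℝ => Real.exp (c * t ^ 2 / 2)) 0 0 := by
    simpa using ((((hasDerivAt_id (0 : ℝ)).pow 2).const_mul (c : ℝ)).div_const 2).exp
  have isLocalMax_zero : IsLocalMax (fun t => mgf W P t - Real.exp (c * t ^ 2 / 2)) 0 :=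
    .of_forall fun t => by simpa using hW.mgf_le t
  simpa using isLocalMax_zero.hasDerivAt_eq_zero (hasDerivAt_mgf_zero.sub hasDerivAt_exp_zero)

variable {X : κ → Ω → ℝ}

lemma iIndepFun_mul (a : κ → ℝ) (hind : iIndepFun X P) : iIndepFun (fun k ω => a k * X k ω) P :=
  hind.comp (fun k x => a k * x) fun _ => by fun_prop

variable [Fintype κ] (z : EuclideanSpace ℝ κ)

lemma hasSubgaussianMGF_sum_mul (hX : ∀ k, HasSubgaussianMGF (X k) c P) (hind : iIndepFun X P) :
    HasSubgaussianMGF (fun ω => ∑ k, z k * X k ω) (‖z‖₊ ^ 2 * c) P := by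
  have hmul (k : κ) : HasSubgaussianMGF (fun ω => z k * X k ω) (‖z k‖₊ ^ 2 * c) P :=
    hasSubgaussianMGF_of_le ((hX k).const_mul (z k)) <| by
      rw [← NNReal.coe_le_coe]
      push_cast
      rw [Real.norm_eq_abs, sq_abs]
      rfl
  refine hasSubgaussianMGF_of_le (HasSubgaussianMGF.sum_of_iIndepFun (s := Finset.univ)
    (iIndepFun_mul z hind) fun k _ => hmul k) (le_of_eq ?_)
  rw [← NNReal.coe_inj, ← Finset.sum_mul]
  push_cast
  rw [EuclideanSpace.norm_sq_eq]

lemma integral_sq_sum_mul [IsProbabilityMeasure P] {v : ℝ}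
    (hX : ∀ k, HasSubgaussianMGF (X k) c P) (hv : ∀ k, ∫ ω, X k ω ^ 2 ∂P = v)
    (hind : iIndepFun X P) : ∫ ω, (∑ k, z k * X k ω) ^ 2 ∂P = ‖z‖ ^ 2 * v := by
  have variance_eq (k : κ) : Var[X k; P] = v := by
    rw [variance_of_integral_eq_zero (hX k).aemeasurable
      (integral_eq_zero_of_hasSubgaussianMGF (hX k)), hv]
  have hsum := hasSubgaussianMGF_sum_mul z hX hind
  have variance_sum := IndepFun.variance_sum (s := Finset.univ) (X := fun k ω => z k * X k ω)
    (fun k _ => ((hX k).memLp 2).const_mul (z k))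
    fun k _ k' _ hkk => (iIndepFun_mul z hind).indepFun hkk
  rw [Finset.sum_fn] at variance_sum
  rw [← variance_of_integral_eq_zero hsum.aemeasurable (integral_eq_zero_of_hasSubgaussianMGF hsum),
    variance_sum, EuclideanSpace.real_norm_sq_eq, Finset.sum_mul]
  simp only [variance_const_mul, variance_eq]

end LinearCombination

section Net

open Metric
open scoped InnerProductSpace

variable {E F : Type*} [NormedAddCommGroup E] [NormedAddCommGroup F]

lemma packingNumber_one_closedBall_two_le [NormedSpace ℝ E] [FiniteDimensional ℝ E] :
    packingNumber 1 (closedBall (0 : E) 2) ≤ 5 ^ Module.finrank ℝ E := by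
  refine iSup₂_le fun C hC => iSup_le fun hsep => ?_
  have card_le (t : Finset E) (ht : (t : Set E) ⊆ C) : t.card ≤ 5 ^ Module.finrank ℝ E := by
    refine Besicovitch.card_le_of_separated t (fun c hc => by simpa using hC (ht hc))
      fun c hc d hd hcd => ?_
    have h : ((1 : ℝ≥0) : ℝ≥0∞) < edist c d := hsep (ht hc) (ht hd) hcd
    rw [edist_nndist, ENNReal.coe_lt_coe, ← NNReal.coe_lt_coe, coe_nndist, dist_eq_norm] at h
    exact h.le
  by_contra! h
  obtain ⟨t, ht, card_t⟩ := Set.exists_subset_encard_eq (Order.add_one_le_of_lt h)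
  have ht_fin : t.Finite := Set.finite_of_encard_eq_coe (k := 5 ^ Module.finrank ℝ E + 1) (by simpa)
  have := card_le ht_fin.toFinset (by simpa)
  rw [ht_fin.encard_eq_coe_toFinset_card] at card_t
  norm_cast at card_t
  omega

lemma exists_finset_isCover_one_closedBall_two [NormedSpace ℝ E] [FiniteDimensional ℝ E] :
    ∃ S : Finset E, S.card ≤ 5 ^ Module.finrank ℝ E ∧ IsCover 1 (closedBall (0 : E) 2) S := by
  have covering_le := (coveringNumber_le_packingNumber 1 _).trans
    (packingNumber_one_closedBall_two_le (E := E))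
  obtain ⟨S, -, S_finite, S_cover, card_S⟩ := exists_set_encard_eq_coveringNumber
    (covering_le.trans_lt (by exact_mod_cast ENat.natCast_lt_top _)).ne
  refine ⟨S_finite.toFinset, ?_, by simpa⟩
  rw [← card_S, S_finite.encard_eq_coe_toFinset_card] at covering_le
  exact_mod_cast covering_le

lemma exists_finset_isCover_closedBall_one [NormedSpace ℝ E] [FiniteDimensional ℝ E] (k : ℕ) :
    ∃ S : Finset E, S.card ≤ (5 ^ k) ^ Module.finrank ℝ E ∧
      IsCover ((1 / 2) ^ k) (closedBall (0 : E) 1) S := by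
  classical
  simp only [isCover_iff_subset_iUnion_closedBall, Set.subset_def, Set.mem_iUnion₂, exists_prop,
    mem_closedBall, dist_eq_norm, sub_zero, Finset.mem_coe]
  obtain ⟨S₁, card_S₁, cover_S₁⟩ := exists_finset_isCover_one_closedBall_two (E := E)
  simp only [isCover_iff_subset_iUnion_closedBall, Set.subset_def, Set.mem_iUnion₂, exists_prop,
    mem_closedBall, dist_eq_norm, sub_zero, Finset.mem_coe] at cover_S₁
  induction k with
  | zero => exact ⟨{0}, by simp, fun x hx => ⟨0, by simp, by simpa using hx⟩⟩
  | succ k ih =>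
    obtain ⟨S, card_S, cover_S⟩ := ih
    refine ⟨(S ×ˢ S₁).image fun p => p.1 + (1 / 2 : ℝ) ^ (k + 1) • p.2, ?_, fun x hx => ?_⟩
    · refine Finset.card_image_le.trans ?_
      rw [Finset.card_product, pow_succ, mul_pow]
      exact Nat.mul_le_mul card_S card_S₁
    · obtain ⟨y, hy, hxy⟩ := cover_S x hx
      push_cast at hxy
      have scaled_le : ‖(2 : ℝ) ^ (k + 1) • (x - y)‖ ≤ 2 := by
        calc ‖(2 : ℝ) ^ (k + 1) • (x - y)‖ = 2 ^ (k + 1) * ‖x - y‖ := by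
              rw [norm_smul, norm_pow, Real.norm_two]
          _ ≤ 2 ^ (k + 1) * (1 / 2) ^ k := by gcongr
          _ = 2 := by rw [pow_succ, mul_right_comm, ← mul_pow]; norm_num
      obtain ⟨w, hw, hyw⟩ := cover_S₁ _ scaled_le
      refine ⟨_, Finset.mem_image_of_mem _ (Finset.mk_mem_product hy hw), ?_⟩
      have sub_eq : x - (y + (1 / 2 : ℝ) ^ (k + 1) • w) =
          (1 / 2 : ℝ) ^ (k + 1) • ((2 : ℝ) ^ (k + 1) • (x - y) - w) := by
        rw [smul_sub, smul_smul, ← mul_pow]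
        norm_num [sub_sub]
      rw [sub_eq, norm_smul]
      simpa using mul_le_mul_of_nonneg_left hyw (by positivity : (0 : ℝ) ≤ (1 / 2) ^ (k + 1))

variable [InnerProductSpace ℝ E] [InnerProductSpace ℝ F]

-- For symmetric `T` one has `⟪T x, x⟫ - ⟪T y, y⟫ = ⟪T (x - y), x + y⟫`.
lemma abs_inner_le_of_norm_sub_le {T : E →L[ℝ] E} (hT : T.IsSymmetric) {x y : E}
    (hx : ‖x‖ ≤ 1) (hxy : ‖x - y‖ ≤ 1 / 4) {η : ℝ} (hη₀ : 0 ≤ η)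
    (hη : |⟪T y, y⟫_ℝ| ≤ η * ‖y‖ ^ 2) : |⟪T x, x⟫_ℝ| ≤ 9 / 16 * ‖T‖ + 25 / 16 * η := by
  have norm_y : ‖y‖ ≤ 5 / 4 := by linarith [norm_le_norm_add_norm_sub' y x, norm_sub_rev x y]
  have inner_sub : ⟪T x, x⟫_ℝ - ⟪T y, y⟫_ℝ = ⟪T (x - y), x + y⟫_ℝ := by
    have := hT x y
    simp only [ContinuousLinearMap.coe_coe] at this
    rw [map_sub, inner_add_right, inner_sub_left, inner_sub_left, this, real_inner_comm (T y)]
    ring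
  have sub_le : |⟪T x, x⟫_ℝ - ⟪T y, y⟫_ℝ| ≤ 9 / 16 * ‖T‖ := by
    calc |⟪T x, x⟫_ℝ - ⟪T y, y⟫_ℝ| ≤ ‖T (x - y)‖ * ‖x + y‖ :=
          inner_sub ▸ abs_real_inner_le_norm _ _
      _ ≤ (‖T‖ * (1 / 4)) * (1 + 5 / 4) := by
          gcongr
          · exact T.le_opNorm_of_le hxy
          · exact norm_add_le_of_le hx norm_y
      _ = 9 / 16 * ‖T‖ := by ring
  calc |⟪T x, x⟫_ℝ| ≤ |⟪T x, x⟫_ℝ - ⟪T y, y⟫_ℝ| + |⟪T y, y⟫_ℝ| := by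
        simpa using abs_add_le (⟪T x, x⟫_ℝ - ⟪T y, y⟫_ℝ) ⟪T y, y⟫_ℝ
    _ ≤ 9 / 16 * ‖T‖ + η * (5 / 4) ^ 2 := add_le_add sub_le (hη.trans (by gcongr))
    _ = 9 / 16 * ‖T‖ + 25 / 16 * η := by ring

lemma norm_le_of_isCover_of_abs_inner_le {T : E →L[ℝ] E} (hT : T.IsSymmetric) {S : Set E}
    (hS : IsCover (1 / 4) (closedBall 0 1) S) {η : ℝ} (hη₀ : 0 ≤ η)
    (hη : ∀ y ∈ S, |⟪T y, y⟫_ℝ| ≤ η * ‖y‖ ^ 2) : ‖T‖ ≤ 4 * η := by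
  have rayleigh_le (x : E) : |T.rayleighQuotient x| ≤ 9 / 16 * ‖T‖ + 25 / 16 * η := by
    rcases eq_or_ne x 0 with rfl | hx
    · simp only [ContinuousLinearMap.rayleighQuotient_apply_zero, abs_zero]
      positivity
    have norm_unit : ‖‖x‖⁻¹ • x‖ = 1 := norm_smul_inv_norm (𝕜 := ℝ) hx
    obtain ⟨y, hy, hxy⟩ := Set.mem_iUnion₂.1
      (hS.subset_iUnion_closedBall (mem_closedBall_zero_iff.2 norm_unit.le))
    rw [mem_closedBall_iff_norm] at hxy
    have := abs_inner_le_of_norm_sub_le hT norm_unit.le hxy hη₀ (hη y hy)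
    rw [← T.rayleigh_smul x (inv_ne_zero (norm_ne_zero_iff.2 hx))]
    simpa [ContinuousLinearMap.rayleighQuotient, ContinuousLinearMap.reApplyInnerSelf_apply,
      norm_unit] using this
  have := (T.norm_eq_iSup_rayleighQuotient hT).trans_le (ciSup_le rayleigh_le)
  linarith

lemma abs_norm_sq_sub_norm_sq_le_of_isCover [CompleteSpace E] [CompleteSpace F] (A : E →L[ℝ] F)
    {S : Set E} (hS : IsCover (1 / 4) (closedBall 0 1) S) {η : ℝ} (hη₀ : 0 ≤ η)
    (hη : ∀ y ∈ S, |‖A y‖ ^ 2 - ‖y‖ ^ 2| ≤ η * ‖y‖ ^ 2) (x : E) :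
    |‖A x‖ ^ 2 - ‖x‖ ^ 2| ≤ 4 * η * ‖x‖ ^ 2 := by
  set T : E →L[ℝ] E := A.adjoint ∘L A - 1
  have inner_eq (y : E) : ⟪T y, y⟫_ℝ = ‖A y‖ ^ 2 - ‖y‖ ^ 2 := by
    simp [T, inner_sub_left, ContinuousLinearMap.adjoint_inner_left]
  have hT : T.IsSymmetric := fun x y => by
    simp [T, inner_sub_left, inner_sub_right, ContinuousLinearMap.adjoint_inner_left,
      ContinuousLinearMap.adjoint_inner_right]
  have norm_T_le := norm_le_of_isCover_of_abs_inner_le hT hS hη₀ (by simpa only [inner_eq])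
  calc |‖A x‖ ^ 2 - ‖x‖ ^ 2| = |⟪T x, x⟫_ℝ| := by rw [inner_eq]
    _ ≤ ‖T x‖ * ‖x‖ := abs_real_inner_le_norm _ _
    _ ≤ 4 * η * ‖x‖ * ‖x‖ := by
        gcongr
        exact T.le_of_opNorm_le norm_T_le x
    _ = 4 * η * ‖x‖ ^ 2 := by ring

end Net

section Coloring

lemma colorable_succ_of_ncard_neighborSet_le {V : Type*} [Finite V] {G : SimpleGraph V} {k : ℕ}
    (hG : ∀ v, (G.neighborSet v).ncard ≤ k) : G.Colorable (k + 1) := by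
  classical
  have := Fintype.ofFinite V
  suffices partial_coloring : ∀ A : Finset V, ∃ C : V → Fin (k + 1),
      ∀ v ∈ A, ∀ w ∈ A, G.Adj v w → C v ≠ C w by
    obtain ⟨C, hC⟩ := partial_coloring Finset.univ
    exact ⟨.mk C fun {v w} => hC v (Finset.mem_univ v) w (Finset.mem_univ w)⟩
  intro A
  induction A using Finset.induction_on with
  | empty => exact ⟨fun _ => 0, by simp⟩
  | insert v A hv ih =>
    obtain ⟨C, hC⟩ := ih
    obtain ⟨c, hc⟩ : ∃ c, c ∉ C '' G.neighborSet v := by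
      rw [← Set.ne_univ_iff_exists_notMem]
      intro image_eq
      have := (Set.ncard_image_le (f := C) (Set.toFinite (G.neighborSet v))).trans (hG v)
      rw [image_eq, Set.ncard_univ, Nat.card_fin] at this
      omega
    have ne_c {w : V} (hvw : G.Adj v w) : C w ≠ c := fun h => hc ⟨w, hvw, h⟩
    refine ⟨Function.update C v c, fun x hx y hy hxy => ?_⟩
    rw [Finset.mem_insert] at hx hy
    rcases hx with rfl | hx <;> rcases hy with rfl | hy
    · exact absurd hxy G.irrefl
    · simpa [hxy.ne'] using (ne_c hxy).symm
    · simpa [hxy.ne] using ne_c hxy.symm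
    · simpa [ne_of_mem_of_not_mem hx hv, ne_of_mem_of_not_mem hy hv] using hC x hx y hy hxy

variable {R κ Q : Type*}

/-- The overlap graph of a matrix whose `(r, t)` entry is the variable number `idx r t`: two rows
are adjacent when they share a variable within the columns in `T`. -/
def overlapGraph (idx : R → κ → Q) (T : Finset κ) : SimpleGraph R where
  Adj r r' := r ≠ r' ∧ ∃ t ∈ T, ∃ t' ∈ T, idx r t = idx r' t'
  symm := ⟨fun _ _ ⟨hne, t, ht, t', ht', h⟩ => ⟨hne.symm, t', ht', t, ht, h.symm⟩⟩

variable {idx : R → κ → Q} {T : Finset κ}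

lemma ncard_neighborSet_overlapGraph_le [Finite R] (hidx : ∀ t, Function.Injective (idx · t))
    (r : R) : ((overlapGraph idx T).neighborSet r).ncard ≤ T.card * (T.card - 1) := by
  classical
  rw [Nat.mul_sub_one, ← Finset.offDiag_card, Set.ncard_eq_toFinset_card _ (Set.toFinite _)]
  refine Finset.card_le_card_of_forall_subsingleton (fun r' p => idx r p.1 = idx r' p.2) ?_ ?_
  · intro r' hr'
    rw [Set.Finite.mem_toFinset] at hr'
    obtain ⟨hne, t, ht, t', ht', h⟩ := hr'
    have column_ne : t ≠ t' := by
      rintro rfl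
      exact hne (hidx t h)
    exact ⟨(t, t'), Finset.mem_offDiag.2 ⟨ht, ht', column_ne⟩, h⟩
  · rintro p - r₁ ⟨-, h₁⟩ r₂ ⟨-, h₂⟩
    exact hidx p.2 (h₁.symm.trans h₂)

lemma colorable_overlapGraph_of_card_le [Finite R] (hidx : ∀ t, Function.Injective (idx · t))
    {s : ℕ} (hT : T.card ≤ s) : (overlapGraph idx T).Colorable (s * (s - 1) + 1) :=
  colorable_succ_of_ncard_neighborSet_le fun r =>
    (ncard_neighborSet_overlapGraph_le hidx r).trans
      (Nat.mul_le_mul hT (Nat.sub_le_sub_right hT 1))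

lemma iIndepFun_rows_of_coloring [Countable R] {Ω ι E : Type*} [MeasurableSpace Ω]
    [MeasurableSpace E] {P : Measure Ω} {X : Q → Ω → E} (hX : ∀ q, AEMeasurable (X q) P)
    (hind : iIndepFun X P) (hidx : ∀ r, Function.Injective (idx r))
    (C : (overlapGraph idx T).Coloring ι) (g : ι) :
    iIndepFun (fun (r : {r // C r = g}) ω (t : T) => X (idx r t) ω) P := by
  have injective : Function.Injective fun p : {r // C r = g} × T => idx p.1 p.2 := by
    rintro ⟨⟨r, hr⟩, t, ht⟩ ⟨⟨r', hr'⟩, t', ht'⟩ h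
    have row_eq : r = r' := by
      by_contra hne
      exact C.valid ⟨hne, t, ht, t', ht', h⟩ (hr.trans hr'.symm)
    subst row_eq
    simpa using hidx r h
  exact iIndepFun_curry (fun p => hX _) (hind.precomp injective)

end Coloring

section CirculantIndex

variable {l₁ l₂ d k₁ k₂ e : ℕ}

/-- The label `(i, j, a, b)` of the random variable `Υ i j a b` that stands in the given row and
column of a two-level circulant block matrix. -/
def circulantIndex (r : Fin l₁ × Fin l₂ × Fin d) (c : Fin k₁ × Fin k₂ × Fin e) :
    ZMod k₁ × ZMod k₂ × Fin d × Fin e :=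
  (((r.1 : ℕ) : ZMod k₁) - ((c.1 : ℕ) : ZMod k₁),
    ((r.2.1 : ℕ) : ZMod k₂) - ((c.2.1 : ℕ) : ZMod k₂), r.2.2, c.2.2)

lemma injective_natCast_zmod_of_le {l k : ℕ} (h : l ≤ k) :
    Function.Injective fun a : Fin l => ((a : ℕ) : ZMod k) := by
  intro a b hab
  rw [ZMod.natCast_eq_natCast_iff', Nat.mod_eq_of_lt (a.2.trans_le h),
    Nat.mod_eq_of_lt (b.2.trans_le h)] at hab
  exact Fin.ext hab

lemma injective_circulantIndex (r : Fin l₁ × Fin l₂ × Fin d) :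
    Function.Injective (circulantIndex (k₁ := k₁) (k₂ := k₂) (e := e) r) := by
  rintro ⟨u, v, b⟩ ⟨u', v', b'⟩ h
  simp only [circulantIndex, Prod.mk.injEq, sub_right_inj] at h
  rw [injective_natCast_zmod_of_le le_rfl h.1, injective_natCast_zmod_of_le le_rfl h.2.1, h.2.2.2]

lemma injective_circulantIndex_left (h₁ : l₁ ≤ k₁) (h₂ : l₂ ≤ k₂)
    (c : Fin k₁ × Fin k₂ × Fin e) :
    Function.Injective fun r : Fin l₁ × Fin l₂ × Fin d => circulantIndex r c := by
  rintro ⟨u, v, a⟩ ⟨u', v', a'⟩ h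
  simp only [circulantIndex, Prod.mk.injEq, sub_left_inj] at h
  rw [injective_natCast_zmod_of_le h₁ h.1, injective_natCast_zmod_of_le h₂ h.2.1, h.2.2.1]

lemma colorable_overlapGraph_circulantIndex (T : Finset (Fin k₁ × Fin k₂ × Fin e)) :
    (overlapGraph (circulantIndex (l₁ := l₁) (l₂ := l₂) (d := d)) T).Colorable (l₁ * l₂) := by
  have C : (overlapGraph (circulantIndex (l₁ := l₁) (l₂ := l₂) (d := d)) T).Coloring
      (Fin l₁ × Fin l₂) := .mk (fun r => (r.1, r.2.1)) <| by
    rintro ⟨u, v, a⟩ ⟨u', v', a'⟩ ⟨hne, t, -, t', -, h⟩ hC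
    simp only [circulantIndex, Prod.mk.injEq] at h hC
    exact hne (by rw [hC.1, hC.2, h.2.2.1])
  simpa using C.colorable

end CirculantIndex

lemma card_filter_card_le_le_pow {κ : Type*} [Fintype κ] {s : ℕ} (hs : 1 ≤ s)
    (hsκ : s ≤ Fintype.card κ) :
    (((Finset.univ : Finset (Finset κ)).filter (·.card ≤ s)).card : ℝ) ≤
      (Real.exp 1 * Fintype.card κ / s) ^ s := by
  set N := Fintype.card κ
  have : (0 : ℝ) < s := by exact_mod_cast hs
  have N_pos : (0 : ℝ) < N := by exact_mod_cast hs.trans hsκ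
  have ratio_le_one : (s / N : ℝ) ≤ 1 := (div_le_one N_pos).2 (by exact_mod_cast hsκ)
  -- Subsets of size at most `s` have weight at least `(s / N) ^ s` in the binomial expansion.
  refine le_of_mul_le_mul_right ?_ (by positivity : (0 : ℝ) < (s / N : ℝ) ^ s)
  calc (((Finset.univ : Finset (Finset κ)).filter (·.card ≤ s)).card : ℝ) * (s / N : ℝ) ^ s
      = ∑ T : Finset κ with T.card ≤ s, (s / N : ℝ) ^ s := by
        rw [Finset.sum_const, nsmul_eq_mul]
    _ ≤ ∑ T : Finset κ with T.card ≤ s, (s / N : ℝ) ^ T.card :=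
        Finset.sum_le_sum fun T hT =>
          pow_le_pow_of_le_one (by positivity) ratio_le_one (Finset.mem_filter.1 hT).2
    _ ≤ ∑ T : Finset κ, (s / N : ℝ) ^ T.card :=
        Finset.sum_le_sum_of_subset_of_nonneg (Finset.filter_subset _ _)
          fun _ _ _ => by positivity
    _ = (s / N + 1) ^ N := by simpa using Fintype.sum_pow_mul_eq_add_pow κ (s / N : ℝ) 1
    _ ≤ Real.exp (s / N) ^ N := by gcongr; exact Real.add_one_le_exp _
    _ = Real.exp 1 ^ s := by
        rw [← Real.exp_nat_mul, ← Real.exp_nat_mul]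
        congr 1
        field_simp
    _ = (Real.exp 1 * N / s) ^ s * (s / N) ^ s := by
        rw [← mul_pow]
        congr 1
        field_simp

namespace EntryDist

instance (D : EntryDist) (n : ℕ) : IsProbabilityMeasure (D.law n) := by
  cases D
  · exact inferInstanceAs (IsProbabilityMeasure (gaussianReal _ _))
  · constructor
    simp [law, ENNReal.inv_two_add_inv_two]
  · constructor
    simp only [law, Measure.coe_add, Measure.coe_smul, Pi.add_apply, Pi.smul_apply, measure_univ,
      smul_eq_mul, mul_one]
    rw [← ENNReal.toReal_eq_one_iff, ENNReal.toReal_add (by finiteness) (by finiteness),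
      ENNReal.toReal_add (by finiteness) (by finiteness)]
    norm_num

lemma integral_law_bernoulli (n : ℕ) (f : ℝ → ℝ) :
    ∫ x, f x ∂(law .bernoulli n) = (f (1 / √n) + f (-(1 / √n))) / 2 := by
  have integrable (a : ℝ) : Integrable f ((1 / 2 : ℝ≥0∞) • Measure.dirac a) :=
    (integrable_dirac (by finiteness)).smul_measure (by finiteness)
  rw [law, integral_add_measure (integrable _) (integrable _), integral_smul_measure,
    integral_smul_measure, integral_dirac, integral_dirac, ← smul_add, smul_eq_mul,
    ENNReal.toReal_div, ENNReal.toReal_one, ENNReal.toReal_ofNat]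
  ring

lemma integral_law_ternary (n : ℕ) (f : ℝ → ℝ) :
    ∫ x, f x ∂(law .ternary n) = (f √(3 / n) + 4 * f 0 + f (-√(3 / n))) / 6 := by
  have integrable (a : ℝ) {c : ℝ≥0∞} (hc : c ≠ ⊤) : Integrable f (c • Measure.dirac a) :=
    (integrable_dirac (by finiteness)).smul_measure hc
  rw [law, integral_add_measure
      ((integrable _ (by finiteness)).add_measure (integrable _ (by finiteness)))
      (integrable _ (by finiteness)),
    integral_add_measure (integrable _ (by finiteness)) (integrable _ (by finiteness))]
  simp only [integral_smul_measure, integral_dirac, smul_eq_mul, ENNReal.toReal_div,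
    ENNReal.toReal_one, ENNReal.toReal_ofNat]
  ring

lemma integral_id_law (D : EntryDist) (n : ℕ) : ∫ x, x ∂(D.law n) = 0 := by
  cases D
  · exact integral_id_gaussianReal
  · rw [integral_law_bernoulli]; ring
  · rw [integral_law_ternary]; ring

lemma integral_sq_law (D : EntryDist) (n : ℕ) : ∫ x, x ^ 2 ∂(D.law n) = 1 / n := by
  cases D
  · have h : Var[id; law .gaussian n] = 1 / n := by simp [law, variance_id_gaussianReal]
    rwa [variance_of_integral_eq_zero aemeasurable_id (integral_id_law _ _)] at h
  · rw [integral_law_bernoulli, neg_sq, div_pow, Real.sq_sqrt n.cast_nonneg]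
    ring
  · rw [integral_law_ternary, neg_sq, Real.sq_sqrt (by positivity)]
    ring

lemma ae_abs_le_law_bernoulli (n : ℕ) : ∀ᵐ x ∂(law .bernoulli n), |x| ≤ √(3 / n) := by
  have h : |1 / √(n : ℝ)| ≤ √(3 / n) := by
    rw [abs_of_nonneg (by positivity), ← Real.sqrt_one, ← Real.sqrt_div zero_le_one]
    gcongr
    norm_num
  have meas : MeasurableSet {x : ℝ | |x| ≤ √(3 / n)} := measurableSet_le (by fun_prop) (by fun_prop)
  rw [law, ae_add_measure_iff]
  exact ⟨Measure.ae_smul_measure ((ae_dirac_iff meas).2 h) _,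
    Measure.ae_smul_measure ((ae_dirac_iff meas).2 (by rwa [abs_neg])) _⟩

lemma ae_abs_le_law_ternary (n : ℕ) : ∀ᵐ x ∂(law .ternary n), |x| ≤ √(3 / n) := by
  have h : |√(3 / n : ℝ)| ≤ √(3 / n) := (abs_of_nonneg (Real.sqrt_nonneg _)).le
  have meas : MeasurableSet {x : ℝ | |x| ≤ √(3 / n)} := measurableSet_le (by fun_prop) (by fun_prop)
  rw [law, ae_add_measure_iff, ae_add_measure_iff]
  exact ⟨⟨Measure.ae_smul_measure ((ae_dirac_iff meas).2 h) _,
    Measure.ae_smul_measure ((ae_dirac_iff meas).2 (by rw [abs_zero]; positivity)) _⟩,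
    Measure.ae_smul_measure ((ae_dirac_iff meas).2 (by rwa [abs_neg])) _⟩

lemma hasSubgaussianMGF_law_of_ae_abs_le {D : EntryDist} {n : ℕ}
    (h : ∀ᵐ x ∂(D.law n), |x| ≤ √(3 / n)) : HasSubgaussianMGF id (3 / n) (D.law n) := by
  convert hasSubgaussianMGF_of_mem_Icc_of_integral_eq_zero aemeasurable_id
    (h.mono fun x hx => abs_le.1 hx) (integral_id_law D n)
  rw [sub_neg_eq_add, ← NNReal.coe_inj]
  push_cast
  rw [Real.norm_of_nonneg (by positivity), add_self_div_two, Real.sq_sqrt (by positivity)]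

lemma hasSubgaussianMGF_law (D : EntryDist) (n : ℕ) : HasSubgaussianMGF id (3 / n) (D.law n) := by
  cases D
  · have h : HasSubgaussianMGF id (1 / n) (law .gaussian n) :=
      ⟨fun t => integrable_exp_mul_gaussianReal t, fun t => by simp [law, mgf_id_gaussianReal]⟩
    exact hasSubgaussianMGF_of_le h (by gcongr; norm_num)
  · exact hasSubgaussianMGF_law_of_ae_abs_le (ae_abs_le_law_bernoulli n)
  · exact hasSubgaussianMGF_law_of_ae_abs_le (ae_abs_le_law_ternary n)

end EntryDist

section RestrictedIsometry

open Metric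

variable {R κ : Type*} [Fintype R]

lemma norm_toLp_submatrix_mulVec_sq (A : Matrix R κ ℝ) (T : Finset κ) (z : EuclideanSpace ℝ T) :
    ‖WithLp.toLp 2 ((A.submatrix id (Subtype.val : T → κ)).mulVec z.ofLp)‖ ^ 2 =
      ∑ r, (∑ t, z t * A r t) ^ 2 := by
  simp only [EuclideanSpace.real_norm_sq_eq, Matrix.mulVec, dotProduct, Matrix.submatrix_apply,
    id, mul_comm]

lemma satisfiesRIP_of_isCover {A : Matrix R κ ℝ} {s : ℕ} {δ : ℝ} (hδ : 0 ≤ δ)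
    {S : ∀ T : Finset κ, Set (EuclideanSpace ℝ T)}
    (hS : ∀ T : Finset κ, T.card ≤ s → IsCover (1 / 4) (closedBall 0 1) (S T))
    (hA : ∀ T : Finset κ, T.card ≤ s → ∀ z ∈ S T,
      |∑ r, (∑ t, z t * A r t) ^ 2 - ‖z‖ ^ 2| ≤ δ / 4 * ‖z‖ ^ 2) : SatisfiesRIP A s δ := by
  classical
  intro T hT z
  let L : EuclideanSpace ℝ T →L[ℝ] EuclideanSpace ℝ R :=
    (Matrix.toLpLin 2 2 (A.submatrix id (Subtype.val : T → κ))).toContinuousLinearMap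
  have norm_L_sq (y : EuclideanSpace ℝ T) : ‖L y‖ ^ 2 = ∑ r, (∑ t, y t * A r t) ^ 2 :=
    norm_toLp_submatrix_mulVec_sq A T y
  have h := abs_norm_sq_sub_norm_sq_le_of_isCover L (hS T hT) (by positivity : 0 ≤ δ / 4)
    (fun y hy => by rw [norm_L_sq]; exact hA T hT y hy) z
  rw [norm_L_sq, abs_le] at h
  rw [norm_toLp_submatrix_mulVec_sq]
  constructor <;> linarith [h.1, h.2]

variable {Ω : Type*} [MeasurableSpace Ω] {P : Measure Ω}

lemma measure_not_satisfiesRIP_le_of_concentration [Fintype κ] {A : Ω → Matrix R κ ℝ} {s : ℕ}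
    (hs : 1 ≤ s) (hsκ : s ≤ Fintype.card κ) {δ : ℝ} (hδ : 0 ≤ δ) {ε : ℝ≥0∞}
    (hA : ∀ T : Finset κ, T.card ≤ s → ∀ z : EuclideanSpace ℝ T,
      P {ω | δ / 4 * ‖z‖ ^ 2 < |∑ r, (∑ t, z t * A ω r t) ^ 2 - ‖z‖ ^ 2|} ≤ ε) :
    P {ω | ¬ SatisfiesRIP (A ω) s δ} ≤
      ENNReal.ofReal ((Real.exp 1 * Fintype.card κ / s) ^ s * 25 ^ s) * ε := by
  choose S card_S isCover_S using fun T : Finset κ =>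
    exists_finset_isCover_closedBall_one (E := EuclideanSpace ℝ T) 2
  norm_num only at card_S isCover_S
  set F := (Finset.univ : Finset (Finset κ)).filter (·.card ≤ s)
  set bad := fun (T : Finset κ) (z : EuclideanSpace ℝ T) =>
    {ω | δ / 4 * ‖z‖ ^ 2 < |∑ r, (∑ t, z t * A ω r t) ^ 2 - ‖z‖ ^ 2|}
  have not_satisfiesRIP_subset : {ω | ¬ SatisfiesRIP (A ω) s δ} ⊆ ⋃ T ∈ F, ⋃ z ∈ S T, bad T z := by
    intro ω hω
    by_contra not_bad
    simp only [F, bad, Set.mem_iUnion, Finset.mem_filter_univ, Set.mem_ofPred_eq, not_exists,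
      not_lt] at not_bad
    exact hω (satisfiesRIP_of_isCover hδ (fun T _ => isCover_S T) not_bad)
  have card_S_le : ∀ T ∈ F, ((S T).card : ℝ≥0∞) ≤ 25 ^ s := by
    intro T hT
    have h := card_S T
    rw [finrank_euclideanSpace, Fintype.card_coe] at h
    exact_mod_cast h.trans (Nat.pow_le_pow_right (by norm_num) (Finset.mem_filter.1 hT).2)
  calc P {ω | ¬ SatisfiesRIP (A ω) s δ}
      ≤ P (⋃ T ∈ F, ⋃ z ∈ S T, bad T z) := measure_mono not_satisfiesRIP_subset
    _ ≤ ∑ T ∈ F, ∑ z ∈ S T, P (bad T z) :=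
        (measure_biUnion_finset_le _ _).trans
          (Finset.sum_le_sum fun T _ => measure_biUnion_finset_le _ _)
    _ ≤ ∑ T ∈ F, (S T).card * ε := by
        refine Finset.sum_le_sum fun T hT => ?_
        rw [← nsmul_eq_mul]
        exact Finset.sum_le_card_nsmul _ _ _ fun z _ => hA T (Finset.mem_filter.1 hT).2 z
    _ ≤ F.card * (25 ^ s * ε) := by
        rw [← nsmul_eq_mul]
        exact Finset.sum_le_card_nsmul _ _ _ fun T hT => mul_le_mul_left (card_S_le T hT) ε
    _ = ENNReal.ofReal (F.card * 25 ^ s) * ε := by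
        rw [ENNReal.ofReal_mul (by positivity), ENNReal.ofReal_natCast,
          ENNReal.ofReal_pow (by norm_num), ENNReal.ofReal_ofNat, mul_assoc]
    _ ≤ _ := by
        gcongr
        exact card_filter_card_le_le_pow hs hsκ

/-- Independent sub-Gaussian variables normalised as the entries of a random matrix with `n` rows:
the second moments are `1 / n`, and the sub-Gaussian parameter `K / n` is proportional to them. -/
structure IsSubgaussianEnsemble {Q Ω : Type*} [MeasurableSpace Ω] (X : Q → Ω → ℝ) (n : ℕ) (K : ℝ≥0)
    (P : Measure Ω) : Prop where
  hasSubgaussianMGF : ∀ q, HasSubgaussianMGF (X q) (K / n) P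
  integral_sq : ∀ q, ∫ ω, X q ω ^ 2 ∂P = 1 / n
  iIndepFun : iIndepFun X P

variable [IsProbabilityMeasure P] {Q : Type*} {X : Q → Ω → ℝ} {idx : R → κ → Q} {K : ℝ≥0}

lemma IsSubgaussianEnsemble.one_le_four_mul [Nonempty Q] {n : ℕ} (hK : K ≠ 0) (hn : n ≠ 0)
    (hX : IsSubgaussianEnsemble X n K P) : 1 ≤ 4 * (K : ℝ) := by
  have n_pos : (0 : ℝ) < n := by positivity
  have q := Classical.arbitrary Q
  have h := integral_sq_le_of_hasSubgaussianMGF (by positivity) (hX.hasSubgaussianMGF q)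
  rw [hX.integral_sq] at h
  push_cast at h
  rwa [← mul_div_assoc, div_le_div_iff_of_pos_right n_pos] at h

lemma hasSubexponentialMGF_row [Nonempty R] (hK : K ≠ 0)
    (hX : IsSubgaussianEnsemble X (Fintype.card R) K P)
    (hidx : ∀ r, Function.Injective (idx r)) {T : Finset κ} {z : EuclideanSpace ℝ T} (hz : z ≠ 0)
    (r : R) :
    HasSubexponentialMGF (fun ω => (∑ t, z t * X (idx r t) ω) ^ 2 - ‖z‖ ^ 2 / Fintype.card R)
      (16 * K * ‖z‖ ^ 2 / Fintype.card R) P := by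
  have row_ind : iIndepFun (fun t : T => X (idx r t)) P :=
    hX.iIndepFun.precomp ((hidx r).comp Subtype.val_injective)
  have z_ne : ‖z‖₊ ≠ 0 := nnnorm_ne_zero_iff.2 hz
  have h := hasSubexponentialMGF_sq_sub_integral_sq (by positivity)
    (hasSubgaussianMGF_sum_mul z (fun t => hX.hasSubgaussianMGF (idx r t)) row_ind)
  rw [integral_sq_sum_mul z (fun _ => hX.hasSubgaussianMGF _) (fun _ => hX.integral_sq _) row_ind]
    at h
  convert h using 1
  · simp only [mul_one_div]
  · push_cast
    ring

lemma measure_sum_sq_deviation_le [Nonempty R] (hK : K ≠ 0)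
    (hX : IsSubgaussianEnsemble X (Fintype.card R) K P)
    (hidx : ∀ r, Function.Injective (idx r)) {T : Finset κ} {ι : Type*} [Fintype ι]
    (C : (overlapGraph idx T).Coloring ι) {η : ℝ} (hη₀ : 0 ≤ η) (hη₁ : η ≤ 1)
    (z : EuclideanSpace ℝ T) :
    P {ω | η * ‖z‖ ^ 2 < |∑ r, (∑ t, z t * X (idx r t) ω) ^ 2 - ‖z‖ ^ 2|} ≤
      2 * ENNReal.ofReal
        (Real.exp (-(η ^ 2 / (1024 * K ^ 2) * (Fintype.card R / Fintype.card ι)))) := by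
  rcases eq_or_ne z 0 with rfl | hz
  · simp
  have r₀ := Classical.arbitrary R
  have : Nonempty ι := ⟨C r₀⟩
  have : (0 : ℝ) < K := by positivity
  have n_pos : (0 : ℝ) < Fintype.card R := by simp [Fintype.card_pos]
  have z_pos : 0 < ‖z‖ := norm_pos_iff.2 hz
  obtain ⟨t₀, -⟩ : ∃ t, z t ≠ 0 := by
    by_contra! h
    exact hz (PiLp.ext h)
  have : Nonempty Q := ⟨idx r₀ t₀⟩
  have one_le : 1 ≤ 4 * (K : ℝ) := hX.one_le_four_mul hK Fintype.card_ne_zero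
  set V := fun r ω => (∑ t, z t * X (idx r t) ω) ^ 2 - ‖z‖ ^ 2 / Fintype.card R with hV
  have sum_V (ω : Ω) : ∑ r, V r ω = ∑ r, (∑ t, z t * X (idx r t) ω) ^ 2 - ‖z‖ ^ 2 := by
    rw [hV, Finset.sum_sub_distrib, Finset.sum_const, Finset.card_univ, nsmul_eq_mul,
      mul_div_cancel₀ _ n_pos.ne']
  have V_ind (g : ι) : iIndepFun (fun r : {r // C r = g} => V r) P :=
    (iIndepFun_rows_of_coloring (fun q => (hX.hasSubgaussianMGF q).aemeasurable)
      hX.iIndepFun hidx C g).comp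
      (fun _ x => (∑ t, z t * x t) ^ 2 - ‖z‖ ^ 2 / Fintype.card R) fun _ => by fun_prop
  have tail := HasSubexponentialMGF.measure_abs_ge_le_of_coloring (t := η * ‖z‖ ^ 2)
    (by positivity) (hasSubexponentialMGF_row hK hX hidx hz) V_ind (by positivity) <| by
      rw [mul_assoc, div_mul_cancel₀ _ n_pos.ne']
      nlinarith [pow_pos z_pos 2]
  calc P {ω | η * ‖z‖ ^ 2 < |∑ r, (∑ t, z t * X (idx r t) ω) ^ 2 - ‖z‖ ^ 2|}
      ≤ P {ω | η * ‖z‖ ^ 2 ≤ |∑ r, V r ω|} := by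
        simp only [sum_V]
        exact measure_mono (Set.ofPred_subset_ofPred.2 fun ω => le_of_lt)
    _ ≤ _ := tail
    _ = _ := by
        congr 4
        field_simp
        ring

lemma measure_not_satisfiesRIP_le_of_colorable [Nonempty R] [Fintype κ] (hK : K ≠ 0)
    (hX : IsSubgaussianEnsemble X (Fintype.card R) K P)
    (hidx : ∀ r, Function.Injective (idx r)) {s q : ℕ} (hs : 1 ≤ s) (hsκ : s ≤ Fintype.card κ)
    (hq : ∀ T : Finset κ, T.card ≤ s → (overlapGraph idx T).Colorable q)
    {δ : ℝ} (hδ : δ ∈ Set.Ioo (0 : ℝ) 1) :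
    P {ω | ¬ SatisfiesRIP (Matrix.of fun r c => X (idx r c) ω) s δ} ≤
      ENNReal.ofReal ((Real.exp 1 * Fintype.card κ / s) ^ s * 25 ^ s *
        (2 * Real.exp (-(δ ^ 2 / (16384 * K ^ 2) * (Fintype.card R / q))))) := by
  rw [ENNReal.ofReal_mul (by positivity), ENNReal.ofReal_mul zero_le_two, ENNReal.ofReal_ofNat]
  refine measure_not_satisfiesRIP_le_of_concentration hs hsκ hδ.1.le fun T hT z => ?_
  have h := measure_sum_sq_deviation_le hK hX hidx (hq T hT).some
    (by linarith [hδ.1] : 0 ≤ δ / 4) (by linarith [hδ.2]) z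
  rw [Fintype.card_fin] at h
  have exponent_eq : (δ / 4) ^ 2 / (1024 * (K : ℝ) ^ 2) = δ ^ 2 / (16384 * K ^ 2) := by ring
  rwa [exponent_eq] at h

end RestrictedIsometry

section CirculantMatrix

lemma exp_four_ge : (25 : ℝ) ≤ Real.exp 4 :=
  calc (25 : ℝ) ≤ 2.7 ^ 4 := by norm_num
    _ ≤ Real.exp 1 ^ 4 := by gcongr; linarith [Real.exp_one_gt_d9]
    _ = Real.exp 4 := by rw [← Real.exp_nat_mul]; norm_num

-- The three factors are at most `exp (3 m L)`, `exp (12 m)` and `exp (1 - x)` with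
-- `L = log (N / m) ≥ log 3 > 1`, and `3 m L + 12 m + 1 ≤ 16 m L ≤ x / 2`.
lemma pow_mul_pow_mul_exp_neg_le_exp_neg_half {m N : ℕ} (hm : 1 ≤ m) (hN : 3 * m ≤ N) {x : ℝ}
    (hx : 32 * (m * Real.log (N / m)) ≤ x) :
    (Real.exp 1 * N / (3 * m : ℕ)) ^ (3 * m) * 25 ^ (3 * m) * (2 * Real.exp (-x)) ≤
      Real.exp (-(x / 2)) := by
  have hm' : (1 : ℝ) ≤ m := by exact_mod_cast hm
  have three_le : (3 : ℝ) ≤ N / m := by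
    rw [le_div_iff₀ (by linarith)]
    exact_mod_cast hN
  have exp_one_le : Real.exp 1 ≤ 3 := by linarith [Real.exp_one_lt_d9]
  have two_le : (2 : ℝ) ≤ Real.exp 1 := by linarith [Real.exp_one_gt_d9]
  set L := Real.log (N / m)
  have exp_L : Real.exp L = N / m := Real.exp_log (by linarith)
  have one_le_L : 1 ≤ L := (Real.le_log_iff_exp_le (by linarith)).2 (by linarith)
  have base_le : Real.exp 1 * N / (3 * m : ℕ) ≤ Real.exp L := by
    rw [exp_L, Nat.cast_mul, Nat.cast_ofNat, mul_div_mul_comm]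
    exact mul_le_of_le_one_left (by positivity) ((div_le_one (by norm_num)).2 exp_one_le)
  calc (Real.exp 1 * N / (3 * m : ℕ)) ^ (3 * m) * 25 ^ (3 * m) * (2 * Real.exp (-x))
      ≤ Real.exp L ^ (3 * m) * Real.exp 4 ^ (3 * m) * (Real.exp 1 * Real.exp (-x)) := by
        gcongr
        exact exp_four_ge
    _ = Real.exp (3 * m * L + 3 * m * 4 + (1 - x)) := by
        rw [← Real.exp_nat_mul, ← Real.exp_nat_mul, ← Real.exp_add, ← Real.exp_add,
          ← Real.exp_add]
        congr 1
        push_cast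
        ring
    _ ≤ Real.exp (-(x / 2)) := by
        rw [Real.exp_le_exp]
        nlinarith [mul_le_mul_of_nonneg_left one_le_L (zero_le_one.trans hm')]

variable {m l₁ k₁ l₂ k₂ d e n N : ℕ} {δ : ℝ} {K : ℝ≥0} {Ω : Type*} [MeasurableSpace Ω]
  {P : Measure Ω} [IsProbabilityMeasure P] {Υ : ZMod k₁ → ZMod k₂ → Ω → Matrix (Fin d) (Fin e) ℝ}

lemma one_sub_exp_le_measureReal_satisfiesRIP_of_colorable (hδ : δ ∈ Set.Ioo (0 : ℝ) 1)
    (hK : K ≠ 0) (hm : 1 ≤ m) (hn : n = l₁ * l₂ * d) (hn₀ : n ≠ 0) (hN : N = k₁ * k₂ * e)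
    (hmN : 3 * m ≤ N)
    (hX : IsSubgaussianEnsemble (fun (q : ZMod k₁ × ZMod k₂ × Fin d × Fin e) ω =>
      Υ q.1 q.2.1 ω q.2.2.1 q.2.2.2) n K P)
    {q : ℕ} (hq : ∀ T : Finset (Fin k₁ × Fin k₂ × Fin e), T.card ≤ 3 * m →
      (overlapGraph (circulantIndex (l₁ := l₁) (l₂ := l₂) (d := d)) T).Colorable q)
    (hnq : 32 * (m * Real.log (N / m)) ≤ δ ^ 2 / (16384 * K ^ 2) * (n / q)) :
    1 - Real.exp (-(δ ^ 2 / (16384 * K ^ 2) * (n / q) / 2)) ≤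
      P.real {ω | SatisfiesRIP
        (circulantBlock l₁ k₁ fun i => circulantBlock l₂ k₂ fun j => Υ i j ω) (3 * m) δ} := by
  have card_rows : Fintype.card (Fin l₁ × Fin l₂ × Fin d) = n := by simp [hn, mul_assoc]
  have card_columns : Fintype.card (Fin k₁ × Fin k₂ × Fin e) = N := by simp [hN, mul_assoc]
  have : Nonempty (Fin l₁ × Fin l₂ × Fin d) := Fintype.card_pos_iff.1 (by lia)
  have failure_le := measure_not_satisfiesRIP_le_of_colorable (P := P) hK
    (by rw [card_rows]; exact hX) injective_circulantIndex
    (by lia : 1 ≤ 3 * m) (by rw [card_columns]; exact hmN) hq hδ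
  rw [card_rows, card_columns] at failure_le
  have failureReal_le := ENNReal.toReal_le_of_le_ofReal (Real.exp_pos _).le <|
    failure_le.trans <| ENNReal.ofReal_le_ofReal <|
      pow_mul_pow_mul_exp_neg_le_exp_neg_half hm hmN hnq
  rw [sub_le_comm]
  set S := {ω | SatisfiesRIP
    (circulantBlock l₁ k₁ fun i => circulantBlock l₂ k₂ fun j => Υ i j ω) (3 * m) δ}
  have one_le : 1 ≤ P.real S + P.real Sᶜ := by
    rw [← probReal_univ (μ := P), ← Set.union_compl_self S]
    exact measureReal_union_le S Sᶜ
  exact (sub_le_iff_le_add'.2 one_le).trans failureReal_le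

lemma one_sub_exp_le_measureReal_satisfiesRIP_of_le_mul (hδ : δ ∈ Set.Ioo (0 : ℝ) 1)
    (hK : K ≠ 0) (hm : 1 ≤ m) (hn : n = l₁ * l₂ * d) (hN : N = k₁ * k₂ * e) (hmN : 3 * m ≤ N)
    (hX : IsSubgaussianEnsemble (fun (q : ZMod k₁ × ZMod k₂ × Fin d × Fin e) ω =>
      Υ q.1 q.2.1 ω q.2.2.1 q.2.2.2) n K P)
    {q : ℕ} (hq₀ : 0 < q) (hq : ∀ T : Finset (Fin k₁ × Fin k₂ × Fin e), T.card ≤ 3 * m →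
      (overlapGraph (circulantIndex (l₁ := l₁) (l₂ := l₂) (d := d)) T).Colorable q)
    {c w : ℝ} (hc : c = δ ^ 2 / (16384 * K ^ 2)) (hw : 0 < w) (hqw : q ≤ 9 * w)
    (hnw : 288 / c * w * m * Real.log (N / m) ≤ n) :
    1 - Real.exp (-(c / 18 * n / w)) ≤
      P.real {ω | SatisfiesRIP
        (circulantBlock l₁ k₁ fun i => circulantBlock l₂ k₂ fun j => Υ i j ω) (3 * m) δ} := by
  have hδ₀ := hδ.1
  have c_pos : 0 < c := by rw [hc]; positivity
  have log_pos : 0 < Real.log (N / m) := by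
    refine Real.log_pos ((one_lt_div (by positivity)).2 ?_)
    exact_mod_cast (by lia : m < N)
  have n_pos : (0 : ℝ) < n := lt_of_lt_of_le (by positivity) hnw
  have n_div_le : c * (n / (9 * w)) ≤ c * (n / q) := by gcongr
  have log_le : 32 * (m * Real.log (N / m)) ≤ c * (n / (9 * w)) := by
    calc 32 * (m * Real.log (N / m))
        = c * (288 / c * w * m * Real.log (N / m) / (9 * w)) := by field_simp; norm_num
      _ ≤ c * (n / (9 * w)) := by gcongr
  subst hc
  refine le_trans ?_ (one_sub_exp_le_measureReal_satisfiesRIP_of_colorable hδ hK hm hn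
    (by exact_mod_cast n_pos.ne') hN hmN hX hq (log_le.trans n_div_le))
  rw [sub_le_sub_iff_left, Real.exp_le_exp, neg_le_neg_iff]
  calc δ ^ 2 / (16384 * K ^ 2) / 18 * n / w = δ ^ 2 / (16384 * K ^ 2) * (n / (9 * w)) / 2 := by
        field_simp
        norm_num
    _ ≤ δ ^ 2 / (16384 * K ^ 2) * (n / q) / 2 := by gcongr

end CirculantMatrix

theorem mainTheorem3_general {δ : ℝ} (hδ : δ ∈ Set.Ioo (0 : ℝ) 1) {K : ℝ≥0} (hK : K ≠ 0) :
    ∃ c₁ > (0 : ℝ), ∃ c₂ > (0 : ℝ),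
      ∀ (m l₁ k₁ l₂ k₂ d e n N : ℕ),
        1 ≤ m → 1 ≤ l₁ → 1 ≤ l₂ → n = l₁ * l₂ * d → N = k₁ * k₂ * e → 3 * m ≤ N →
      ∀ (Ω : Type*) [MeasurableSpace Ω] (P : Measure Ω) [IsProbabilityMeasure P]
        (Υ : ZMod k₁ → ZMod k₂ → Ω → Matrix (Fin d) (Fin e) ℝ),
        IsSubgaussianEnsemble (fun (q : ZMod k₁ × ZMod k₂ × Fin d × Fin e) ω =>
          Υ q.1 q.2.1 ω q.2.2.1 q.2.2.2) n K P →
        (c₁ * (l₁ * l₂) * m * Real.log (N / m) ≤ n →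
          1 - Real.exp (-(c₂ * n / (l₁ * l₂))) ≤
            P.real {ω | SatisfiesRIP
              (circulantBlock l₁ k₁ fun i => circulantBlock l₂ k₂ fun j => Υ i j ω)
              (3 * m) δ}) ∧
        (l₁ ≤ k₁ → l₂ ≤ k₂ → c₁ * m ^ 3 * Real.log (N / m) ≤ n →
          1 - Real.exp (-(c₂ * n / m ^ 2)) ≤
            P.real {ω | SatisfiesRIP
              (circulantBlock l₁ k₁ fun i => circulantBlock l₂ k₂ fun j => Υ i j ω)
              (3 * m) δ}) := by
  have hδ₀ := hδ.1
  set c : ℝ := δ ^ 2 / (16384 * K ^ 2) with hc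
  refine ⟨288 / c, by positivity, c / 18, by positivity, ?_⟩
  intro m l₁ k₁ l₂ k₂ d e n N hm hl₁ hl₂ hn hN hmN Ω _ P _ Υ hX
  have l_pos : (0 : ℝ) < l₁ * l₂ := by positivity
  constructor
  · intro hnl
    exact one_sub_exp_le_measureReal_satisfiesRIP_of_le_mul hδ hK hm hn hN hmN hX
      (q := l₁ * l₂) (by positivity) (fun T _ => colorable_overlapGraph_circulantIndex T) hc l_pos
      (by push_cast; linarith) hnl
  · intro hlk₁ hlk₂ hnm
    refine one_sub_exp_le_measureReal_satisfiesRIP_of_le_mul hδ hK hm hn hN hmN hX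
      (q := 3 * m * (3 * m - 1) + 1) (by positivity)
      (fun T => colorable_overlapGraph_of_card_le (injective_circulantIndex_left hlk₁ hlk₂)) hc
      (by positivity : (0 : ℝ) < (m : ℝ) ^ 2) ?_ ((le_of_eq (by ring)).trans hnm)
    have colors_le : 3 * m * (3 * m - 1) + 1 ≤ 9 * m ^ 2 := by
      rw [Nat.mul_sub_one]
      have : 3 * m ≤ 3 * m * (3 * m) := Nat.le_mul_of_pos_right _ (by lia)
      lia
    exact_mod_cast colors_le

lemma EntryDist.isSubgaussianEnsemble_of_hasLaw {D : EntryDist} {n : ℕ} {Q Ω : Type*}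
    [MeasurableSpace Ω] {P : Measure Ω} {X : Q → Ω → ℝ} (hlaw : ∀ q, HasLaw (X q) (D.law n) P)
    (hind : iIndepFun X P) : IsSubgaussianEnsemble X n 3 P where
  hasSubgaussianMGF q := by
    rw [← HasSubgaussianMGF.id_map_iff (hlaw q).aemeasurable, (hlaw q).map_eq]
    exact D.hasSubgaussianMGF_law n
  integral_sq q := by
    rw [← D.integral_sq_law n]
    exact (hlaw q).integral_comp (f := (· ^ 2)) (by fun_prop)
  iIndepFun := hind

theorem mainTheorem3 (δ : ℝ) (hδ : δ ∈ Set.Ioo (0 : ℝ) 1) :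
    ∃ c₁ > (0 : ℝ), ∃ c₂ > (0 : ℝ),
      ∀ (m l₁ k₁ l₂ k₂ d e n N : ℕ),
        1 ≤ m → 1 ≤ l₁ → l₁ ≤ k₁ → 1 ≤ l₂ → l₂ ≤ k₂ →
        n = l₁ * l₂ * d → N = k₁ * k₂ * e → 3 * m ≤ N →
      ∀ (D : EntryDist) (Ω : Type*) [MeasurableSpace Ω] (P : Measure Ω) [IsProbabilityMeasure P]
        (Υ : ZMod k₁ → ZMod k₂ → Ω → Matrix (Fin d) (Fin e) ℝ),
        (∀ i j a b, HasLaw (fun ω => Υ i j ω a b) (D.law n) P) →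
        iIndepFun (fun (q : ZMod k₁ × ZMod k₂ × Fin d × Fin e) (ω : Ω) =>
          Υ q.1 q.2.1 ω q.2.2.1 q.2.2.2) P →
        (l₁ * l₂ ≤ 3 * m * (3 * m - 1) →
          c₁ * (l₁ * l₂) * m * Real.log (N / m) ≤ n →
          1 - Real.exp (-(c₂ * n / (l₁ * l₂))) ≤
            P.real {ω | SatisfiesRIP
              (circulantBlock l₁ k₁ fun i => circulantBlock l₂ k₂ fun j => Υ i j ω)
              (3 * m) δ}) ∧
        (3 * m * (3 * m - 1) < l₁ * l₂ →
          c₁ * m ^ 3 * Real.log (N / m) ≤ n →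
          1 - Real.exp (-(c₂ * n / m ^ 2)) ≤
            P.real {ω | SatisfiesRIP
              (circulantBlock l₁ k₁ fun i => circulantBlock l₂ k₂ fun j => Υ i j ω)
              (3 * m) δ}) := by
  obtain ⟨c₁, hc₁, c₂, hc₂, h⟩ := mainTheorem3_general hδ (three_ne_zero (α := ℝ≥0))
  refine ⟨c₁, hc₁, c₂, hc₂, fun m l₁ k₁ l₂ k₂ d e n N hm hl₁ hlk₁ hl₂ hlk₂ hn hN hmN D Ω _ P _ Υ
    hlaw hind => ?_⟩
  obtain ⟨h₁, h₂⟩ := h m l₁ k₁ l₂ k₂ d e n N hm hl₁ hl₂ hn hN hmN Ω P Υ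
    (EntryDist.isSubgaussianEnsemble_of_hasLaw (fun q => hlaw _ _ _ _) hind)
  exact ⟨fun _ => h₁, fun _ => h₂ hlk₁ hlk₂⟩
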